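/- Let $\Phi=(\phi_n)_{n\in\mathbb Z}$ be an i.i.d. sequence of random variables with values in $[0,1]$, and let $\mathcal Z=(Z_n)_{n\in\mathbb Z}$ be an i.i.d. sequence of non-negative integer-valued random variables, independent of $\Phi$. Let $B=(B_{n,k})_{n\in\mathbb Z,\,k\in\mathbb N}$ be a family of random variables, independent of $\mathcal Z$, such that, conditionally on $\Phi$, the $B_{n,k}$ are independent with $P(B_{n,k}=1\mid\Phi)=\phi_n$ and $P(B_{n,k}=0\mid\Phi)=1-\phi_n$. Given an initial value $X_0$ independent of $(\Phi,\mathcal Z,B)$, let $$X_n=\sum_{k=1}^{X_{n-1}}B_{n,k}+Z_n,\qquad n\ge 1,$$ let $S_n=\sum_{k=1}^n X_k$, and denote by $P_0$ the law of the process started from $X_0=0$. Assume that $P(\phi_0=1)<1$ and $E[Z_0]<\infty$. Then there is exactly one probability distribution $\pi$ on the non-negative integers such that $(X_n)_{n\ge0}$ is a stationary sequence when $X_0$ has law $\pi$. Denoting by $E[X_0]=\sum_{x\ge0}x\,\pi(\{x\})$ the mean of $X_0$ under this stationary law, we have $E[X_0]<\infty$ and $$\lim_{n\to\infty}\frac{S_n}{n}=E[X_0]=\frac{E[Z_0]}{1-E[\phi_0]}\qquad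 P_0\text{-almost surely}.$$ -/

import Mathlib

open MeasureTheory ProbabilityTheory Filter
open scoped Topology

/-- The sigma-algebra generated by the random environment `Φ = (φ_n)_{n ∈ ℤ}`. Conditioning on it
gives the quenched law `P_Φ`. -/
abbrev envSigma {Ω : Type*} (Φ : ℤ → Ω → ℝ) : MeasurableSpace Ω :=
  MeasurableSpace.comap (fun ω n => Φ n ω) MeasurableSpace.pi

/-- The coefficients of a first-order random coefficient integer-valued autoregressive process:
`Φ` is an i.i.d. sequence in `[0,1]`; `Z` is an i.i.d. sequence of non-negative integers,
independent of `Φ`; `B` is a family independent of `Z` which, given `Φ`, consists of independent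
variables, `B n k` being Bernoulli with parameter `Φ n`. (The individuals present at time `n - 1`
are numbered `k = 0, 1, 2, …`; `B n k` tells whether the `k`-th one survives to time `n`.) -/
structure IsRCINARCoeff {Ω : Type*} [MeasurableSpace Ω] (μ : Measure Ω)
    (Φ : ℤ → Ω → ℝ) (Z : ℤ → Ω → ℕ) (B : ℤ → ℕ → Ω → ℕ) : Prop where
  measurable_env : ∀ n, Measurable (Φ n)
  measurable_imm : ∀ n, Measurable (Z n)
  measurable_thin : ∀ n k, Measurable (B n k)
  env_mem : ∀ n ω, Φ n ω ∈ Set.Icc (0 : ℝ) 1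
  env_indep : iIndepFun Φ μ
  env_ident : ∀ n, IdentDistrib (Φ n) (Φ 0) μ μ
  imm_indep : iIndepFun Z μ
  imm_ident : ∀ n, IdentDistrib (Z n) (Z 0) μ μ
  env_imm_indep : IndepFun (fun ω n => Φ n ω) (fun ω n => Z n ω) μ
  thin_imm_indep : IndepFun (fun ω n k => B n k ω) (fun ω n => Z n ω) μ
  thin_one : ∀ n k, μ⟦B n k ⁻¹' {1} | envSigma Φ⟧ =ᵐ[μ] fun ω => Φ n ω
  thin_zero : ∀ n k, μ⟦B n k ⁻¹' {0} | envSigma Φ⟧ =ᵐ[μ] fun ω => 1 - Φ n ω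
  thin_condIndep : ∀ (T : Finset (ℤ × ℕ)) (b : ℤ × ℕ → ℕ),
    μ⟦⋂ p ∈ T, B p.1 p.2 ⁻¹' {b p} | envSigma Φ⟧ =ᵐ[μ]
      fun ω => ∏ p ∈ T, (μ⟦B p.1 p.2 ⁻¹' {b p} | envSigma Φ⟧) ω

/-- The process `X_n = ∑_{k ≤ X_{n-1}} B_{n,k} + Z_n`, `n ≥ 1`, with initial value `X₀`. -/
def rcinar {Ω : Type*} (B : ℤ → ℕ → Ω → ℕ) (Z : ℤ → Ω → ℕ) (X₀ : Ω → ℕ) : ℕ → Ω → ℕ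
  | 0 => X₀
  | n + 1 => fun ω =>
      (∑ k ∈ Finset.range (rcinar B Z X₀ n ω), B ((n : ℤ) + 1) k ω) + Z ((n : ℤ) + 1) ω

/-- Partial sums `S_n = X_1 + ⋯ + X_n`. -/
def partialSum {Ω : Type*} (X : ℕ → Ω → ℕ) (n : ℕ) (ω : Ω) : ℕ :=
  ∑ k ∈ Finset.Icc 1 n, X k ω

/-- `π` is a stationary distribution: it is a probability measure on `ℕ`, and the process started
from an initial value with law `π`, independent of the coefficients, is a stationary sequence
(the shifted sequence has the same law on the path space `ℕ → ℕ` as the sequence itself). The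
initial value is realized as the first coordinate on the product space `ℕ × Ω`. -/
def IsStationaryLaw {Ω : Type*} [MeasurableSpace Ω] (μ : Measure Ω)
    (Z : ℤ → Ω → ℕ) (B : ℤ → ℕ → Ω → ℕ) (π : Measure ℕ) : Prop :=
  IsProbabilityMeasure π ∧
    let X : ℕ → ℕ × Ω → ℕ :=
      rcinar (fun n k p => B n k p.2) (fun n p => Z n p.2) (fun p => p.1)
    (π.prod μ).map (fun p n => X (n + 1) p) = (π.prod μ).map (fun p n => X n p)

/-! The pairs formed by the survival indicators of a generation and its number of immigrants are
i.i.d. over generations: given `Φ` the indicators are independent Bernoulli variables, and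
integrating out the i.i.d. `Φ` keeps generations independent. So the process iterates one random
map, monotone in the state, whose mean is `x ↦ a * x + z` with `a = E[φ_0] < 1` and `z = E[Z_0]`.

Start empty at time `n - m`. The state at time `n` increases with `m` and has mean at most `z / (1 -
a)`, so its limit `statFlow n` is almost surely finite. It commutes with the time shift, follows the
recursion and depends only on the past; this gives a stationary law, whose finite mean solves `s = a
* s + z`. Starting from `x` instead of `0` adds `a ^ m * x` to the mean, which is summable, so the
two populations coalesce (`ae_eventually_popFlow_eq_statFlow`); this forces uniqueness.

For the law of large numbers, the process started empty at time `0` lies below `statFlow` and, from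
time `m` on, above the depth-`m` flow. The latter has finite-range dependence, so the classical
strong law applies along residue classes. The gap between the two bounds has mean tending to `0` as
`m` grows, and the maximal ergodic inequality makes its averages small uniformly in time
(`ae_exists_sum_statFlow_sub_le`). -/

/-! ### Maximal ergodic inequality -/

/-- The running maximum of the Birkhoff sums of `f`, floored at `0`. -/
noncomputable def birkhoffMax {α : Type*} (T : α → α) (f : α → ℝ) : ℕ → α → ℝ
  | 0, _ => 0
  | n + 1, x => max 0 (f x + birkhoffMax T f n (T x))

theorem birkhoffMax_nonneg {α : Type*} (T : α → α) (f : α → ℝ) (n : ℕ) (x : α) :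
    0 ≤ birkhoffMax T f n x := by
  cases n with
  | zero => exact le_rfl
  | succ n => exact le_max_left _ _

theorem birkhoffMax_le_succ {α : Type*} (T : α → α) (f : α → ℝ) (n : ℕ) (x : α) :
    birkhoffMax T f n x ≤ birkhoffMax T f (n + 1) x := by
  induction n generalizing x with
  | zero => exact birkhoffMax_nonneg T f _ x
  | succ n ih => exact max_le_max le_rfl (by linarith [ih (T x)])

theorem birkhoffSum_le_birkhoffMax {α : Type*} (T : α → α) (f : α → ℝ) (n : ℕ) (x : α) :
    birkhoffSum T f n x ≤ birkhoffMax T f n x := by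
  induction n generalizing x with
  | zero => simp [birkhoffMax]
  | succ n ih =>
    rw [birkhoffSum_succ']
    exact (add_le_add le_rfl (ih (T x))).trans (le_max_right _ _)

theorem measurable_birkhoffMax {α : Type*} [MeasurableSpace α] {T : α → α} {f : α → ℝ}
    (hT : Measurable T) (hf : Measurable f) (n : ℕ) : Measurable (birkhoffMax T f n) := by
  induction n with
  | zero => exact measurable_const
  | succ n ih => exact measurable_const.max (hf.add (ih.comp hT))

theorem integrable_birkhoffMax {α : Type*} [MeasurableSpace α] {μ : Measure α}
    {T : α → α} {f : α → ℝ} (hT : MeasurePreserving T μ μ) (hf : Integrable f μ) (n : ℕ) :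
    Integrable (birkhoffMax T f n) μ := by
  induction n with
  | zero => exact integrable_zero _ _ _
  | succ n ih => exact (integrable_zero _ _ _).sup (hf.add (hT.integrable_comp_of_integrable ih))

/-- The maximal ergodic theorem (Hopf, Garsia), for running maxima. -/
theorem setIntegral_birkhoffMax_pos_nonneg {α : Type*} [MeasurableSpace α] {μ : Measure α}
    {T : α → α} {f : α → ℝ} (hT : MeasurePreserving T μ μ) (hf : Integrable f μ)
    (hfm : Measurable f) (n : ℕ) :
    0 ≤ ∫ x in {x | 0 < birkhoffMax T f n x}, f x ∂μ := by
  have hM := integrable_birkhoffMax hT hf n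
  have hA : MeasurableSet {x | 0 < birkhoffMax T f n x} :=
    measurableSet_lt measurable_const (measurable_birkhoffMax hT.measurable hfm n)
  have hMT : Integrable (fun x => birkhoffMax T f n (T x)) μ := hT.integrable_comp_of_integrable hM
  have h0 : ∫ x, (birkhoffMax T f n x - birkhoffMax T f n (T x)) ∂μ = 0 := by
    have := integral_map (μ := μ) (φ := T) (f := birkhoffMax T f n)
      hT.measurable.aemeasurable
      (measurable_birkhoffMax hT.measurable hfm n).aestronglyMeasurable
    rw [hT.map_eq] at this
    rw [integral_sub hM hMT, ← this, sub_self]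
  rw [← integral_indicator hA]
  -- Writing `M` for the running maximum, `M - M ∘ T` has integral zero; it is at most `f` where `0
  -- < M`, and at most `0` elsewhere because there `M` vanishes.
  refine h0.symm.le.trans (integral_mono (hM.sub hMT) (hf.indicator hA) fun x => ?_)
  simp only [Set.indicator_apply, Set.mem_ofPred_eq]
  split_ifs with h
  · cases n with
    | zero => exact absurd h (lt_irrefl _)
    | succ n =>
      have h1 : birkhoffMax T f (n + 1) x = f x + birkhoffMax T f n (T x) := by
        have h' : 0 < max 0 (f x + birkhoffMax T f n (T x)) := h
        exact max_eq_right (by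
          by_contra hc
          rw [max_eq_left (not_le.1 hc).le] at h'
          exact lt_irrefl _ h')
      linarith [birkhoffMax_le_succ T f n (T x)]
  · linarith [not_lt.1 h, birkhoffMax_nonneg T f n (T x)]

/-- The weak-type maximal inequality for Birkhoff averages of a non-negative function. -/
theorem measure_exists_lt_birkhoffSum_le {α : Type*} [MeasurableSpace α] {μ : Measure α}
    [IsProbabilityMeasure μ] {T : α → α} {g : α → ℝ} (hT : MeasurePreserving T μ μ)
    (hg : Integrable g μ) (hgm : Measurable g) (hg0 : 0 ≤ g) {c : ℝ} (hc : 0 < c) :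
    μ {x | ∃ n : ℕ, c * n < birkhoffSum T g n x} ≤ ENNReal.ofReal ((∫ x, g x ∂μ) / c) := by
  -- A Birkhoff sum of `g` exceeds `c * n` exactly when that of `g - c` is positive.
  set f : α → ℝ := fun x => g x - c with hf
  have hfi : Integrable f μ := hg.sub (integrable_const c)
  have hfm : Measurable f := hgm.sub_const c
  have hsub : {x | ∃ n : ℕ, c * n < birkhoffSum T g n x} ⊆
      ⋃ n, {x | 0 < birkhoffMax T f n x} := by
    rintro x ⟨n, hn⟩
    refine Set.mem_iUnion.2 ⟨n, lt_of_lt_of_le ?_ (birkhoffSum_le_birkhoffMax T f n x)⟩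
    have : birkhoffSum T f n x = birkhoffSum T g n x - c * n := by
      simp [birkhoffSum, hf, Finset.sum_sub_distrib, mul_comm]
    rw [this]; linarith
  refine (measure_mono hsub).trans ?_
  have hmono : Monotone fun n => {x | 0 < birkhoffMax T f n x} :=
    monotone_nat_of_le_succ fun n x hx => lt_of_lt_of_le hx (birkhoffMax_le_succ T f n x)
  rw [hmono.measure_iUnion]
  refine iSup_le fun n => ?_
  have hA : MeasurableSet {x | 0 < birkhoffMax T f n x} :=
    measurableSet_lt measurable_const (measurable_birkhoffMax hT.measurable hfm n)
  have h := setIntegral_birkhoffMax_pos_nonneg hT hfi hfm n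
  rw [hf, integral_sub hg.integrableOn (integrable_const c).integrableOn, setIntegral_const,
    smul_eq_mul] at h
  have h2 := setIntegral_le_integral (s := {x | 0 < birkhoffMax T f n x}) hg
    (Eventually.of_forall hg0)
  rw [← ENNReal.ofReal_toReal (measure_ne_top μ {x | 0 < birkhoffMax T f n x})]
  refine ENNReal.ofReal_le_ofReal ?_
  rw [le_div_iff₀ hc]
  change μ.real {x | 0 < birkhoffMax T f n x} * c ≤ _
  linarith

/-! ### Strong law under finite-range dependence -/

/-- Monotonicity squeezes `s n` between its values at the multiples of `d` on either side of `n`. -/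
theorem Monotone.tendsto_div_of_tendsto_mul_div {s : ℕ → ℝ} (hs : Monotone s) {d : ℕ}
    (hd : 0 < d) {l : ℝ} (h : Tendsto (fun q : ℕ => s (d * q) / q) atTop (𝓝 (d * l))) :
    Tendsto (fun n : ℕ => s n / n) atTop (𝓝 l) := by
  have hd' : (0 : ℝ) < d := by exact_mod_cast hd
  have hq : Tendsto (fun n : ℕ => n / d) atTop atTop := Nat.tendsto_div_const_atTop hd.ne'
  have hr : Tendsto (fun n : ℕ => ((n / d : ℕ) : ℝ) / n) atTop (𝓝 (1 / d)) := by
    have := (tendsto_nat_floor_mul_div_atTop (R := ℝ) (a := 1 / d) (by positivity)).comp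
      tendsto_natCast_atTop_atTop
    refine this.congr fun n => ?_
    simp only [Function.comp_apply]
    rw [one_div_mul_eq_div, Nat.floor_div_eq_div]
  have hr' : Tendsto (fun n : ℕ => ((n / d + 1 : ℕ) : ℝ) / n) atTop (𝓝 (1 / d)) := by
    have := hr.add (tendsto_const_div_atTop_nhds_zero_nat (1 : ℝ))
    rw [add_zero] at this
    refine this.congr fun n => ?_
    push_cast; ring
  have e : (d : ℝ) * l * (1 / d) = l := by field_simp
  have h1 := (h.comp hq).mul hr
  have h2 := (h.comp ((tendsto_add_atTop_nat 1).comp hq)).mul hr'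
  rw [e] at h1 h2
  refine tendsto_of_tendsto_of_tendsto_of_le_of_le' h1 h2 ?_ ?_
  · filter_upwards [eventually_ge_atTop d] with n hn
    have hn' : 0 < n / d := Nat.div_pos hn hd
    have : (0 : ℝ) < (n / d : ℕ) := by exact_mod_cast hn'
    simp only [Function.comp_apply]
    rw [div_mul_div_cancel₀ this.ne']
    gcongr
    exact hs (Nat.mul_div_le n d)
  · filter_upwards with n
    have : (0 : ℝ) < (n / d + 1 : ℕ) := by positivity
    simp only [Function.comp_apply]
    rw [div_mul_div_cancel₀ this.ne']
    gcongr
    exact hs (Nat.lt_mul_div_succ n hd).le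

theorem Finset.sum_range_mul_eq_sum_residues {M : Type*} [AddCommMonoid M] (u : ℕ → M)
    (d q : ℕ) :
    ∑ i ∈ Finset.range (d * q), u i
      = ∑ r ∈ Finset.range d, ∑ j ∈ Finset.range q, u (d * j + r) := by
  rw [Finset.sum_comm]
  induction q with
  | zero => simp
  | succ q ih => rw [Nat.mul_succ, Finset.sum_range_add, ih, Finset.sum_range_succ]

/-- The strong law of large numbers for identically distributed non-negative variables which are
pairwise independent as soon as their indices are at distance at least `d`. -/
theorem strong_law_ae_of_indepFun_of_dist {Ω : Type*} [MeasurableSpace Ω] {μ : Measure Ω}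
    (u : ℕ → Ω → ℝ) (h0 : ∀ n ω, 0 ≤ u n ω) (hint : Integrable (u 0) μ)
    (hident : ∀ n, IdentDistrib (u n) (u 0) μ μ) {d : ℕ} (hd : 0 < d)
    (hindep : ∀ i j, i + d ≤ j → IndepFun (u i) (u j) μ) :
    ∀ᵐ ω ∂μ, Tendsto (fun n : ℕ => (∑ i ∈ Finset.range n, u i ω) / n) atTop
      (𝓝 (∫ ω, u 0 ω ∂μ)) := by
  -- Within a residue class modulo `d` the variables are pairwise independent, which is all that
  -- Etemadi's strong law needs.
  have key : ∀ r, ∀ᵐ ω ∂μ, Tendsto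
      (fun q : ℕ => (∑ j ∈ Finset.range q, u (d * j + r) ω) / q) atTop
      (𝓝 (∫ ω, u 0 ω ∂μ)) := by
    intro r
    have hi : ∀ i j, i < j → IndepFun (u (d * i + r)) (u (d * j + r)) μ := fun i j hij =>
      hindep _ _ (by nlinarith)
    have := strong_law_ae_real (μ := μ) (fun j => u (d * j + r))
      ((hident (d * 0 + r)).integrable_iff.2 hint) (fun i j hij => by
        rcases lt_or_gt_of_ne hij with h | h
        · exact hi i j h
        · exact (hi j i h).symm)
      (fun i => (hident _).trans (hident _).symm)
    rwa [(hident (d * 0 + r)).integral_eq] at this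
  filter_upwards [ae_all_iff.2 key] with ω hω
  refine Monotone.tendsto_div_of_tendsto_mul_div
    (s := fun n => ∑ i ∈ Finset.range n, u i ω) ?_ hd ?_
  · exact monotone_nat_of_le_succ fun n => by
      rw [Finset.sum_range_succ]; linarith [h0 n ω]
  · have := tendsto_finsetSum (Finset.range d) fun r _ => hω r
    simp only [Finset.sum_const, Finset.card_range, nsmul_eq_mul] at this
    refine this.congr fun q => ?_
    rw [Finset.sum_range_mul_eq_sum_residues, Finset.sum_div]

/-! ### The monotone flow driven by the noise -/

/-- The noise of one generation: the survival indicators and the number of immigrants. -/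
abbrev Noise := (ℕ → ℕ) × ℕ

/-- The state of the population after one generation with noise `e`, starting from `x`. -/
def popStep (x : ℕ) (e : Noise) : ℕ := (∑ k ∈ Finset.range x, e.1 k) + e.2

/-- `popFlow x m n w` is the state at time `n` of the population started from `x` at time
`n - m` and driven by the noise `w`. -/
def popFlow (x : ℕ) : ℕ → ℤ → (ℤ → Noise) → ℕ
  | 0, _, _ => x
  | m + 1, n, w => popStep (popFlow x m (n - 1) w) (w n)

/-- The state at time `n` of the population started empty in the infinitely distant past. -/
noncomputable def statFlow (n : ℤ) (w : ℤ → Noise) : ℕ := ⨆ m, popFlow 0 m n w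

/-- The sigma-algebra generated by the noise at the times in `S`. -/
abbrev noiseSigma (S : Set ℤ) : MeasurableSpace (ℤ → Noise) :=
  ⨆ i ∈ S, MeasurableSpace.comap (fun w : ℤ → Noise => w i) inferInstance

/-- The time shift on noise sequences. -/
def noiseShift (k : ℤ) (w : ℤ → Noise) : ℤ → Noise := fun i => w (i + k)

theorem popStep_mono {x y : ℕ} (h : x ≤ y) (e : Noise) : popStep x e ≤ popStep y e :=
  Nat.add_le_add_right (Finset.sum_le_sum_of_subset (Finset.range_mono h)) _

theorem measurable_popStep : Measurable fun p : ℕ × Noise => popStep p.1 p.2 := by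
  refine measurable_from_prod_countable_right fun x => ?_
  have h : Measurable fun e : Noise => ∑ k ∈ Finset.range x, e.1 k :=
    Finset.measurable_sum _ fun k _ => by fun_prop
  exact h.add measurable_snd

theorem popFlow_le_of_le {x y : ℕ} (h : x ≤ y) (m : ℕ) (n : ℤ) (w : ℤ → Noise) :
    popFlow x m n w ≤ popFlow y m n w := by
  induction m generalizing n with
  | zero => exact h
  | succ m ih => exact popStep_mono (ih _) _

/-- A population started empty one step earlier is at least empty at the later starting time, and
each step preserves order. -/
theorem popFlow_zero_mono (n : ℤ) (w : ℤ → Noise) : Monotone fun m => popFlow 0 m n w := by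
  refine monotone_nat_of_le_succ fun m => ?_
  induction m generalizing n with
  | zero => exact Nat.zero_le _
  | succ m ih => exact popStep_mono (ih _) _

theorem popFlow_add (x m : ℕ) (n k : ℤ) (w : ℤ → Noise) :
    popFlow x m (n + k) w = popFlow x m n (noiseShift k w) := by
  induction m generalizing n with
  | zero => rfl
  | succ m ih =>
    simp only [popFlow]
    rw [← ih, show n + k - 1 = n - 1 + k by ring]
    rfl

theorem statFlow_add (n k : ℤ) (w : ℤ → Noise) :
    statFlow (n + k) w = statFlow n (noiseShift k w) := by
  simp only [statFlow, popFlow_add]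

theorem noiseSigma_le (S : Set ℤ) : noiseSigma S ≤ MeasurableSpace.pi :=
  iSup₂_le fun i _ => (measurable_pi_apply i).comap_le

theorem noiseSigma_mono {S T : Set ℤ} (h : S ⊆ T) : noiseSigma S ≤ noiseSigma T :=
  biSup_mono h

theorem measurable_noiseSigma_eval {S : Set ℤ} {i : ℤ} (hi : i ∈ S) :
    Measurable[noiseSigma S] fun w : ℤ → Noise => w i :=
  measurable_iff_comap_le.2
    (le_iSup₂ (f := fun i (_ : i ∈ S) =>
      MeasurableSpace.comap (fun w : ℤ → Noise => w i) inferInstance) i hi)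

/-- The finite window of noise recorded here makes flows over disjoint windows independent. -/
theorem measurable_popFlow (x m : ℕ) (n : ℤ) :
    Measurable[noiseSigma (Set.Ioc (n - m) n)] (popFlow x m n) := by
  induction m generalizing n with
  | zero => exact measurable_const
  | succ m ih =>
    refine measurable_popStep.comp (Measurable.prodMk ?_ ?_)
    · refine (ih (n - 1)).mono (noiseSigma_mono fun i hi => ?_) le_rfl
      simp only [Set.mem_Ioc] at hi ⊢
      push_cast
      omega
    · exact measurable_noiseSigma_eval (by simp only [Set.mem_Ioc]; push_cast; omega)

theorem measurable_popFlow' (x m : ℕ) (n : ℤ) : Measurable (popFlow x m n) :=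
  (measurable_popFlow x m n).mono (noiseSigma_le _) le_rfl

theorem measurable_statFlow (n : ℤ) : Measurable[noiseSigma (Set.Iic n)] (statFlow n) :=
  Measurable.iSup (mδ := noiseSigma (Set.Iic n)) fun m => (measurable_popFlow 0 m n).mono
    (noiseSigma_mono fun _ hi => hi.2) le_rfl

theorem measurable_statFlow' (n : ℤ) : Measurable (statFlow n) :=
  (measurable_statFlow n).mono (noiseSigma_le _) le_rfl

theorem measurable_noiseShift (k : ℤ) : Measurable (noiseShift k) := by
  unfold noiseShift
  fun_prop

/-- A bounded increasing sequence of integers is eventually constant. Boundedness is essential: an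
unbounded supremum in `ℕ` takes the default value `0`. -/
theorem exists_forall_popFlow_eq_statFlow {n : ℤ} {w : ℤ → Noise}
    (h : BddAbove (Set.range fun m => popFlow 0 m n w)) :
    ∃ M, ∀ m, M ≤ m → popFlow 0 m n w = statFlow n w := by
  obtain ⟨M, hM⟩ := Nat.sSup_mem (Set.range_nonempty fun m => popFlow 0 m n w) h
  exact ⟨M, fun m hm => le_antisymm (le_ciSup h m) (hM.symm.le.trans (popFlow_zero_mono n w hm))⟩

/-! ### Means, finiteness and coalescence under i.i.d. noise -/

section law

variable (ρ : Measure Noise) [IsProbabilityMeasure ρ]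

/-- The law of an i.i.d. noise sequence indexed by `ℤ`. -/
noncomputable abbrev noiseLaw : Measure (ℤ → Noise) := Measure.infinitePi fun _ : ℤ => ρ

theorem measurePreserving_noiseShift (k : ℤ) :
    MeasurePreserving (noiseShift k) (noiseLaw ρ) (noiseLaw ρ) :=
  ⟨measurable_noiseShift k,
    Measure.map_infinitePi_infinitePi_of_inj (P := fun _ : ℤ => ρ) (add_left_injective k)⟩

theorem indep_noiseSigma {S T : Set ℤ} (h : Disjoint S T) :
    Indep (noiseSigma S) (noiseSigma T) (noiseLaw ρ) :=
  indep_iSup_of_disjoint (fun i => (measurable_pi_apply i).comap_le)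
    (iIndepFun_infinitePi (P := fun _ : ℤ => ρ) (X := fun _ e => e) fun _ => measurable_id) h

theorem indepFun_of_noiseSigma {S T : Set ℤ} (h : Disjoint S T) {α β : Type*}
    [MeasurableSpace α] [MeasurableSpace β] {f : (ℤ → Noise) → α} {g : (ℤ → Noise) → β}
    (hf : Measurable[noiseSigma S] f) (hg : Measurable[noiseSigma T] g) :
    IndepFun f g (noiseLaw ρ) :=
  indep_of_indep_of_le_left (indep_of_indep_of_le_right (indep_noiseSigma ρ h) hg.comap_le)
    hf.comap_le

theorem map_eval_noiseLaw (i : ℤ) : (noiseLaw ρ).map (fun w => w i) = ρ :=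
  Measure.infinitePi_map_eval (fun _ : ℤ => ρ) i

variable {ρ} {a z : ENNReal}
  (hb : ∀ k, ∫⁻ e, (e.1 k : ENNReal) ∂ρ = a) (hz : ∫⁻ e, (e.2 : ENNReal) ∂ρ = z)

include hb hz in
-- The current state is independent of the fresh noise, so Fubini applies. Only the means of the
-- indicators enter; their dependence within a generation, through the common `φ_n`, is harmless.
theorem lintegral_popStep {S : Set ℤ} {g : (ℤ → Noise) → ℕ} (hg : Measurable[noiseSigma S] g)
    {i : ℤ} (hi : i ∉ S) :
    ∫⁻ w, (popStep (g w) (w i) : ENNReal) ∂noiseLaw ρ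
      = a * ∫⁻ w, (g w : ENNReal) ∂noiseLaw ρ + z := by
  have hgm : Measurable g := hg.mono (noiseSigma_le _) le_rfl
  have hind : IndepFun g (fun w => w i) (noiseLaw ρ) :=
    indepFun_of_noiseSigma ρ (T := {i}) (by simpa using hi) hg
      (measurable_noiseSigma_eval rfl)
  have hmap := (indepFun_iff_map_prod_eq_prod_map_map hgm.aemeasurable
    (measurable_pi_apply i).aemeasurable).1 hind
  rw [map_eval_noiseLaw] at hmap
  have hcast : Measurable fun p : ℕ × Noise => (popStep p.1 p.2 : ENNReal) :=
    (measurable_of_countable (fun n : ℕ => (n : ENNReal))).comp measurable_popStep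
  have hP := Measure.isProbabilityMeasure_map (μ := noiseLaw ρ) hgm.aemeasurable
  calc ∫⁻ w, (popStep (g w) (w i) : ENNReal) ∂noiseLaw ρ
      = ∫⁻ p, (popStep p.1 p.2 : ENNReal) ∂((noiseLaw ρ).map fun w => (g w, w i)) :=
        (lintegral_map (μ := noiseLaw ρ) hcast (hgm.prodMk (measurable_pi_apply i))).symm
    _ = ∫⁻ x, ∫⁻ e, (popStep x e : ENNReal) ∂ρ ∂((noiseLaw ρ).map g) := by
        rw [hmap, lintegral_prod _ hcast.aemeasurable]
    _ = ∫⁻ x, (a * x + z) ∂((noiseLaw ρ).map g) := by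
        refine lintegral_congr fun x => ?_
        simp only [popStep, Nat.cast_add, Nat.cast_sum]
        have hk : ∀ k, Measurable fun e : Noise => (e.1 k : ENNReal) := fun k =>
          (measurable_of_countable (fun n : ℕ => (n : ENNReal))).comp (by fun_prop)
        rw [lintegral_add_left (Finset.measurable_sum _ fun k _ => hk k), hz,
          lintegral_finsetSum _ fun k _ => hk k]
        simp [hb, mul_comm]
    _ = a * ∫⁻ w, (g w : ENNReal) ∂noiseLaw ρ + z := by
        rw [lintegral_add_right _ measurable_const, lintegral_const,
          lintegral_const_mul _ (measurable_of_countable _),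
          lintegral_map (measurable_of_countable _) hgm]
        simp

include hb hz in
theorem lintegral_popFlow_succ (x m : ℕ) (n : ℤ) :
    ∫⁻ w, (popFlow x (m + 1) n w : ENNReal) ∂noiseLaw ρ
      = a * ∫⁻ w, (popFlow x m (n - 1) w : ENNReal) ∂noiseLaw ρ + z :=
  lintegral_popStep hb hz (measurable_popFlow x m (n - 1)) (by simp)

theorem mul_mul_inv_one_sub_add (ha : a < 1) : a * (z * (1 - a)⁻¹) + z = z * (1 - a)⁻¹ := by
  have h1 : (1 - a) * (1 - a)⁻¹ = 1 :=
    ENNReal.mul_inv_cancel (tsub_pos_of_lt ha).ne' (by simp)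
  calc a * (z * (1 - a)⁻¹) + z = a * (z * (1 - a)⁻¹) + z * ((1 - a) * (1 - a)⁻¹) := by
        rw [h1, mul_one]
    _ = (a + (1 - a)) * (z * (1 - a)⁻¹) := by ring
    _ = z * (1 - a)⁻¹ := by rw [add_tsub_cancel_of_le ha.le, one_mul]

include hb hz in
theorem lintegral_popFlow_zero_le (ha : a < 1) (m : ℕ) (n : ℤ) :
    ∫⁻ w, (popFlow 0 m n w : ENNReal) ∂noiseLaw ρ ≤ z * (1 - a)⁻¹ := by
  induction m generalizing n with
  | zero => simp [popFlow]
  | succ m ih =>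
    rw [lintegral_popFlow_succ hb hz, ← mul_mul_inv_one_sub_add ha]
    gcongr
    exact ih _

include hb hz in
theorem lintegral_popFlow (x m : ℕ) (n : ℤ) :
    ∫⁻ w, (popFlow x m n w : ENNReal) ∂noiseLaw ρ
      = a ^ m * x + ∫⁻ w, (popFlow 0 m n w : ENNReal) ∂noiseLaw ρ := by
  induction m generalizing n with
  | zero => simp [popFlow]
  | succ m ih =>
    rw [lintegral_popFlow_succ hb hz, lintegral_popFlow_succ hb hz, ih]
    ring

theorem measurable_popFlow_cast (x m : ℕ) (n : ℤ) :
    Measurable fun w => (popFlow x m n w : ENNReal) :=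
  (measurable_of_countable (fun n : ℕ => (n : ENNReal))).comp (measurable_popFlow' x m n)

theorem mul_inv_one_sub_ne_top (ha : a < 1) (hzt : z ≠ ⊤) : z * (1 - a)⁻¹ ≠ ⊤ :=
  ENNReal.mul_ne_top hzt (ENNReal.inv_ne_top.2 (tsub_pos_of_lt ha).ne')

include hb hz in
theorem lintegral_iSup_popFlow_le (ha : a < 1) (n : ℤ) :
    ∫⁻ w, (⨆ m, (popFlow 0 m n w : ENNReal)) ∂noiseLaw ρ ≤ z * (1 - a)⁻¹ := by
  rw [lintegral_iSup (fun m => measurable_popFlow_cast 0 m n)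
    fun m m' h w => Nat.cast_le.2 (popFlow_zero_mono n w h)]
  exact iSup_le fun m => lintegral_popFlow_zero_le hb hz ha m n

include hb hz in
theorem ae_bddAbove_popFlow (ha : a < 1) (hzt : z ≠ ⊤) :
    ∀ᵐ w ∂noiseLaw ρ, ∀ n, BddAbove (Set.range fun m => popFlow 0 m n w) := by
  rw [ae_all_iff]
  intro n
  -- The supremum is taken in `ENNReal`, where unboundedness shows up as `⊤`.
  have := ae_lt_top (Measurable.iSup fun m => measurable_popFlow_cast 0 m n)
    ((lintegral_iSup_popFlow_le hb hz ha n).trans_lt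
      (mul_inv_one_sub_ne_top ha hzt).lt_top).ne
  filter_upwards [this] with w hw
  obtain ⟨N, hN⟩ := ENNReal.exists_nat_gt hw.ne
  refine ⟨N, ?_⟩
  rintro _ ⟨m, rfl⟩
  exact Nat.cast_le.1 ((le_iSup (fun m => (popFlow 0 m n w : ENNReal)) m).trans hN.le)

theorem statFlow_succ_eq {n : ℤ} {w : ℤ → Noise}
    (h : ∀ n, BddAbove (Set.range fun m => popFlow 0 m n w)) :
    statFlow (n + 1) w = popStep (statFlow n w) (w (n + 1)) := by
  obtain ⟨M, hM⟩ := exists_forall_popFlow_eq_statFlow (h n)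
  obtain ⟨M', hM'⟩ := exists_forall_popFlow_eq_statFlow (h (n + 1))
  -- Both suprema are attained along a common starting time, which is one generation deeper when
  -- seen from `n + 1`.
  rw [← hM' (max M M' + 1) (by omega), ← hM (max M M') (by omega)]
  simp [popFlow]

theorem popFlow_le_statFlow {n : ℤ} {w : ℤ → Noise}
    (h : BddAbove (Set.range fun m => popFlow 0 m n w)) (m : ℕ) :
    popFlow 0 m n w ≤ statFlow n w := le_ciSup h m

include hb hz in
theorem tendsto_lintegral_popFlow (ha : a < 1) (hzt : z ≠ ⊤) (n : ℤ) :
    Tendsto (fun m => ∫⁻ w, (popFlow 0 m n w : ENNReal) ∂noiseLaw ρ) atTop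
      (𝓝 (∫⁻ w, (statFlow n w : ENNReal) ∂noiseLaw ρ)) := by
  refine lintegral_tendsto_of_tendsto_of_monotone
    (fun m => (measurable_popFlow_cast 0 m n).aemeasurable)
    (Eventually.of_forall fun w m m' h => Nat.cast_le.2 (popFlow_zero_mono n w h)) ?_
  filter_upwards [ae_bddAbove_popFlow hb hz ha hzt] with w hw
  obtain ⟨M, hM⟩ := exists_forall_popFlow_eq_statFlow (hw n)
  exact tendsto_const_nhds.congr' (eventually_atTop.2 ⟨M, fun m hm => by simp only [hM m hm]⟩)

include hb hz in
-- Shift invariance turns the one-step recursion into `s = a * s + z`. The a priori bound gives `s ≠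
-- ⊤`, without which the equation could not be solved for `s`.
theorem lintegral_statFlow (ha : a < 1) (hzt : z ≠ ⊤) (n : ℤ) :
    ∫⁻ w, (statFlow n w : ENNReal) ∂noiseLaw ρ = z * (1 - a)⁻¹ := by
  have hle : ∀ n, ∫⁻ w, (statFlow n w : ENNReal) ∂noiseLaw ρ ≤ z * (1 - a)⁻¹ := fun n =>
    le_of_tendsto' (tendsto_lintegral_popFlow hb hz ha hzt n)
      fun m => lintegral_popFlow_zero_le hb hz ha m n
  have hshift : ∫⁻ w, (statFlow (n - 1) w : ENNReal) ∂noiseLaw ρ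
      = ∫⁻ w, (statFlow n w : ENNReal) ∂noiseLaw ρ := by
    have := (measurePreserving_noiseShift ρ 1).lintegral_comp
      ((measurable_of_countable (fun n : ℕ => (n : ENNReal))).comp (measurable_statFlow' (n - 1)))
    simp only [Function.comp_apply, ← statFlow_add, sub_add_cancel] at this
    exact this.symm
  have hrec : ∫⁻ w, (statFlow n w : ENNReal) ∂noiseLaw ρ
      = a * ∫⁻ w, (statFlow n w : ENNReal) ∂noiseLaw ρ + z := by
    conv_lhs => rw [← lintegral_congr_ae (f := fun w =>
      (popStep (statFlow (n - 1) w) (w n) : ENNReal)) (by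
        filter_upwards [ae_bddAbove_popFlow hb hz ha hzt] with w hw
        have := statFlow_succ_eq (n := n - 1) hw
        rw [sub_add_cancel] at this
        rw [this])]
    rw [lintegral_popStep hb hz (measurable_statFlow (n - 1)) (by simp), hshift]
  set s := ∫⁻ w, (statFlow n w : ENNReal) ∂noiseLaw ρ
  have hs : s ≠ ⊤ := ((hle n).trans_lt (mul_inv_one_sub_ne_top ha hzt).lt_top).ne
  have h1 : s * (1 - a) = z := by
    rw [ENNReal.mul_sub (fun _ _ => hs), mul_one, mul_comm]
    exact ENNReal.sub_eq_of_eq_add (ENNReal.mul_ne_top (ha.trans ENNReal.one_lt_top).ne hs)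
      (by rw [add_comm]; exact hrec)
  rw [← h1, mul_assoc, ENNReal.mul_inv_cancel (tsub_pos_of_lt ha).ne' (by simp), mul_one]

include hb hz in
/-- Two populations started from different states in the distant past have coalesced. -/
theorem ae_eventually_popFlow_eq_statFlow (ha : a < 1) (hzt : z ≠ ⊤) (x : ℕ) (n : ℤ) :
    ∀ᵐ w ∂noiseLaw ρ, ∀ᶠ m in atTop, popFlow x m n w = statFlow n w := by
  have hle : ∀ m w, popFlow 0 m n w ≤ popFlow x m n w := fun m w =>
    popFlow_le_of_le (Nat.zero_le x) m n w
  have hm : ∀ m, Measurable fun w => ((popFlow x m n w - popFlow 0 m n w : ℕ) : ENNReal) :=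
    fun m => (measurable_of_countable (fun n : ℕ => (n : ENNReal))).comp
      ((measurable_popFlow' x m n).sub (measurable_popFlow' 0 m n))
  have hd : ∀ m, ∫⁻ w, ((popFlow x m n w - popFlow 0 m n w : ℕ) : ENNReal) ∂noiseLaw ρ
      = a ^ m * x := by
    intro m
    have h := lintegral_popFlow hb hz x m n
    have h2 : ∫⁻ w, (popFlow x m n w : ENNReal) ∂noiseLaw ρ
        = ∫⁻ w, ((popFlow x m n w - popFlow 0 m n w : ℕ) : ENNReal) ∂noiseLaw ρ
          + ∫⁻ w, (popFlow 0 m n w : ENNReal) ∂noiseLaw ρ := by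
      rw [← lintegral_add_left (hm m)]
      refine lintegral_congr fun w => ?_
      rw [← Nat.cast_add, Nat.sub_add_cancel (hle m w)]
    exact (ENNReal.add_left_inj ((lintegral_popFlow_zero_le hb hz ha m n).trans_lt
      (mul_inv_one_sub_ne_top ha hzt).lt_top).ne).1 (h2.symm.trans h)
  -- The expected discrepancies form a convergent geometric series, so almost surely the
  -- discrepancies tend to `0`; being integers, they are eventually `0`.
  have hsum : ∫⁻ w, ∑' m, ((popFlow x m n w - popFlow 0 m n w : ℕ) : ENNReal) ∂noiseLaw ρ
      ≠ ⊤ := by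
    rw [lintegral_tsum fun m => (hm m).aemeasurable]
    simp only [hd]
    rw [ENNReal.tsum_mul_right, ENNReal.tsum_geometric]
    exact ENNReal.mul_ne_top (ENNReal.inv_ne_top.2 (tsub_pos_of_lt ha).ne')
      (ENNReal.natCast_ne_top x)
  filter_upwards [ae_lt_top (Measurable.tsum hm) hsum,
    ae_bddAbove_popFlow hb hz ha hzt] with w hw hbd
  have ht := ENNReal.tendsto_atTop_zero_of_tsum_ne_top hw.ne
  obtain ⟨M, hM⟩ := exists_forall_popFlow_eq_statFlow (hbd n)
  filter_upwards [ht.eventually (gt_mem_nhds zero_lt_one), eventually_ge_atTop M] with m h1 h2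
  rw [← hM m h2]
  have : popFlow x m n w - popFlow 0 m n w < 1 := by exact_mod_cast h1
  exact le_antisymm (by omega) (hle m w)

end law

/-! ### Law of large numbers for the process started empty -/

theorem integrable_natCast_of_lintegral_ne_top {Ω : Type*} [MeasurableSpace Ω] {μ : Measure Ω}
    {f : Ω → ℕ} (hf : Measurable f) (h : ∫⁻ ω, (f ω : ENNReal) ∂μ ≠ ⊤) :
    Integrable (fun ω => (f ω : ℝ)) μ := by
  have := integrable_toReal_of_lintegral_ne_top (μ := μ)
    ((measurable_of_countable (fun n : ℕ => (n : ENNReal))).comp hf).aemeasurable h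
  simpa using this

theorem integral_natCast_eq_toReal_lintegral {Ω : Type*} [MeasurableSpace Ω] {μ : Measure Ω}
    {f : Ω → ℕ} (hf : Measurable f) :
    ∫ ω, (f ω : ℝ) ∂μ = (∫⁻ ω, (f ω : ENNReal) ∂μ).toReal := by
  have := integral_toReal (μ := μ)
    ((measurable_of_countable (fun n : ℕ => (n : ENNReal))).comp hf).aemeasurable
    (Eventually.of_forall fun ω => ENNReal.natCast_lt_top (f ω))
  simpa using this

theorem iterate_noiseShift_one (k : ℕ) (w : ℤ → Noise) :
    (noiseShift 1)^[k] w = noiseShift k w := by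
  induction k generalizing w with
  | zero =>
    funext i
    simp [noiseShift]
  | succ k ih =>
    rw [Function.iterate_succ_apply, ih]
    funext i
    simp only [noiseShift]
    congr 1
    push_cast
    ring

section law

variable {ρ : Measure Noise} [IsProbabilityMeasure ρ] {a z : ENNReal}
  (hb : ∀ k, ∫⁻ e, (e.1 k : ENNReal) ∂ρ = a) (hz : ∫⁻ e, (e.2 : ENNReal) ∂ρ = z)
  (ha : a < 1) (hzt : z ≠ ⊤)

include hb hz ha hzt

theorem integrable_popFlow (m : ℕ) (n : ℤ) :
    Integrable (fun w => (popFlow 0 m n w : ℝ)) (noiseLaw ρ) :=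
  integrable_natCast_of_lintegral_ne_top (measurable_popFlow' 0 m n)
    ((lintegral_popFlow_zero_le hb hz ha m n).trans_lt (mul_inv_one_sub_ne_top ha hzt).lt_top).ne

theorem integrable_statFlow (n : ℤ) :
    Integrable (fun w => (statFlow n w : ℝ)) (noiseLaw ρ) :=
  integrable_natCast_of_lintegral_ne_top (measurable_statFlow' n)
    (by rw [lintegral_statFlow hb hz ha hzt]; exact mul_inv_one_sub_ne_top ha hzt)

theorem tendsto_integral_popFlow (n : ℤ) :
    Tendsto (fun m => ∫ w, (popFlow 0 m n w : ℝ) ∂noiseLaw ρ) atTop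
      (𝓝 (∫ w, (statFlow n w : ℝ) ∂noiseLaw ρ)) := by
  rw [integral_natCast_eq_toReal_lintegral (measurable_statFlow' n)]
  simp only [integral_natCast_eq_toReal_lintegral (measurable_popFlow' 0 _ n)]
  refine (ENNReal.tendsto_toReal ?_).comp (tendsto_lintegral_popFlow hb hz ha hzt n)
  rw [lintegral_statFlow hb hz ha hzt]
  exact mul_inv_one_sub_ne_top ha hzt

theorem ae_tendsto_average_popFlow (m : ℕ) :
    ∀ᵐ w ∂noiseLaw ρ, Tendsto
      (fun N : ℕ => (∑ k ∈ Finset.range N, (popFlow 0 m (k + 1) w : ℝ)) / N) atTop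
      (𝓝 (∫ w, (popFlow 0 m 1 w : ℝ) ∂noiseLaw ρ)) := by
  have hcast : Measurable fun n : ℕ => (n : ℝ) := measurable_of_countable _
  have h := strong_law_ae_of_indepFun_of_dist (μ := noiseLaw ρ)
    (fun k w => (popFlow 0 m (k + 1) w : ℝ)) (fun _ _ => Nat.cast_nonneg _)
    (integrable_popFlow hb hz ha hzt m _)
    (fun k => by
      have h1 : (fun w => (popFlow 0 m (k + 1) w : ℝ))
          = (fun w => (popFlow 0 m ((0 : ℕ) + 1) w : ℝ)) ∘ noiseShift k := by
        funext w
        simp only [Function.comp_apply, ← popFlow_add]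
        rw [show ((0 : ℕ) : ℤ) + 1 + k = k + 1 by push_cast; ring]
      have hm : Measurable fun w => (popFlow 0 m ((0 : ℕ) + 1) w : ℝ) :=
        hcast.comp (measurable_popFlow' _ _ _)
      rw [h1]
      refine ⟨(hm.comp (measurable_noiseShift _)).aemeasurable, hm.aemeasurable, ?_⟩
      rw [← Measure.map_map hm (measurable_noiseShift _),
        (measurePreserving_noiseShift ρ _).map_eq])
    -- Lag `m` already separates the windows; `m + 1` keeps the lag positive when `m = 0`.
    (d := m + 1) m.succ_pos
    (fun i j hij => by
      refine (indepFun_of_noiseSigma ρ ?_ (measurable_popFlow 0 m (i + 1))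
        (measurable_popFlow 0 m (j + 1))).comp hcast hcast
      rw [Set.disjoint_left]
      intro k h1 h2
      simp only [Set.mem_Ioc] at h1 h2
      omega)
  simpa using h

theorem ae_exists_sum_statFlow_sub_le {ε : ℝ} (hε : 0 < ε) (M : ℕ) :
    ∀ᵐ w ∂noiseLaw ρ, ∃ m, M ≤ m ∧ ∀ N : ℕ,
      ∑ k ∈ Finset.range N, (statFlow (k + 1) w : ℝ)
        ≤ ∑ k ∈ Finset.range N, (popFlow 0 m (k + 1) w : ℝ) + ε * N := by
  -- Truncated subtraction makes `g m` non-negative and the comparison `hsum` valid at every `w`,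
  -- even where `statFlow` has its default value.
  set g : ℕ → (ℤ → Noise) → ℝ := fun m w => ((statFlow 1 w - popFlow 0 m 1 w : ℕ) : ℝ) with hg
  have hcast : Measurable fun n : ℕ => (n : ℝ) := measurable_of_countable _
  have hgm : ∀ m, Measurable (g m) := fun m =>
    hcast.comp ((measurable_statFlow' 1).sub (measurable_popFlow' 0 m 1))
  have hgae : ∀ m, g m =ᵐ[noiseLaw ρ] fun w => (statFlow 1 w : ℝ) - popFlow 0 m 1 w := by
    intro m
    filter_upwards [ae_bddAbove_popFlow hb hz ha hzt] with w hw
    simp only [hg]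
    rw [Nat.cast_sub (popFlow_le_statFlow (hw 1) m)]
  have hgi : ∀ m, Integrable (g m) (noiseLaw ρ) := fun m =>
    ((integrable_statFlow hb hz ha hzt 1).sub (integrable_popFlow hb hz ha hzt m 1)).congr
      (hgae m).symm
  have hlim : Tendsto (fun m => ENNReal.ofReal ((∫ w, g m w ∂noiseLaw ρ) / ε)) atTop (𝓝 0) := by
    have h1 : ∀ m, ∫ w, g m w ∂noiseLaw ρ = ∫ w, (statFlow 1 w : ℝ) ∂noiseLaw ρ
        - ∫ w, (popFlow 0 m 1 w : ℝ) ∂noiseLaw ρ := fun m => by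
      rw [integral_congr_ae (hgae m), integral_sub (integrable_statFlow hb hz ha hzt 1)
        (integrable_popFlow hb hz ha hzt m 1)]
    have h2 := (ENNReal.tendsto_ofReal
      ((((tendsto_integral_popFlow hb hz ha hzt 1).const_sub
        (∫ w, (statFlow 1 w : ℝ) ∂noiseLaw ρ))).div_const ε))
    simp only [h1]
    simpa using h2
  have hsum : ∀ m N w, ∑ k ∈ Finset.range N, (statFlow (k + 1) w : ℝ)
      ≤ ∑ k ∈ Finset.range N, (popFlow 0 m (k + 1) w : ℝ)
        + birkhoffSum (noiseShift 1) (g m) N w := by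
    intro m N w
    rw [birkhoffSum, ← Finset.sum_add_distrib]
    refine Finset.sum_le_sum fun k _ => ?_
    simp only [hg, iterate_noiseShift_one, ← statFlow_add, ← popFlow_add]
    rw [add_comm (1 : ℤ)]
    have : statFlow (k + 1) w ≤ popFlow 0 m (k + 1) w
      + (statFlow (k + 1) w - popFlow 0 m (k + 1) w) := by omega
    exact_mod_cast this
  rw [ae_iff]
  -- The exceptional set lies in the maximal-inequality event of every `m ≥ M`, and the
  -- probabilities of these events tend to `0`.
  refine le_antisymm (ge_of_tendsto hlim ?_) bot_le
  filter_upwards [eventually_ge_atTop M] with m hm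
  refine le_trans (measure_mono fun w hw => ?_) (measure_exists_lt_birkhoffSum_le
    (measurePreserving_noiseShift ρ 1) (hgi m) (hgm m) (fun w => Nat.cast_nonneg _) hε)
  simp only [Set.mem_ofPred_eq, not_exists, not_and, not_forall, not_le] at hw ⊢
  obtain ⟨N, hN⟩ := hw m hm
  exact ⟨N, by linarith [hsum m N w]⟩

/-- The law of large numbers for the population started empty at time `0`. -/
theorem ae_tendsto_average_popFlow_diag :
    ∀ᵐ w ∂noiseLaw ρ, Tendsto
      (fun N : ℕ => (∑ k ∈ Finset.range N, (popFlow 0 (k + 1) (k + 1) w : ℝ)) / N) atTop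
      (𝓝 (∫ w, (statFlow 1 w : ℝ) ∂noiseLaw ρ)) := by
  -- Tolerances `1 / (j + 1)` form a countable family, so one null set serves for all of them.
  have h1 : ∀ᵐ w ∂noiseLaw ρ, ∀ j M : ℕ, ∃ m, M ≤ m ∧ ∀ N : ℕ,
      ∑ k ∈ Finset.range N, (statFlow (k + 1) w : ℝ)
        ≤ ∑ k ∈ Finset.range N, (popFlow 0 m (k + 1) w : ℝ) + 1 / ((j : ℝ) + 1) * N := by
    simp only [ae_all_iff]
    exact fun j M => ae_exists_sum_statFlow_sub_le hb hz ha hzt (by positivity) M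
  filter_upwards [h1, ae_all_iff.2 (ae_tendsto_average_popFlow hb hz ha hzt),
    ae_bddAbove_popFlow hb hz ha hzt] with w hw hconv hbd
  rw [Metric.tendsto_atTop]
  intro ε hε
  obtain ⟨j, hj⟩ := exists_nat_one_div_lt (show 0 < ε / 4 by positivity)
  obtain ⟨M, hM⟩ := Metric.tendsto_atTop.1 (tendsto_integral_popFlow hb hz ha hzt 1) (ε / 4)
    (by positivity)
  obtain ⟨m, hmM, hm⟩ := hw j M
  obtain ⟨N₁, hN₁⟩ := Metric.tendsto_atTop.1 (hconv m) (ε / 4) (by positivity)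
  -- Only for `k < m` can the depth-`m` flow exceed the process, whose depth is `k + 1`; `C` absorbs
  -- these finitely many terms.
  set C : ℝ := ∑ k ∈ Finset.range m, (popFlow 0 m (k + 1) w : ℝ) with hC
  obtain ⟨N₂, hN₂⟩ := Metric.tendsto_atTop.1 (tendsto_const_div_atTop_nhds_zero_nat C) (ε / 4)
    (by positivity)
  refine ⟨max (max N₁ N₂) 1, fun N hN => ?_⟩
  have hNpos : (0 : ℝ) < N := by
    have : 0 < N := by omega
    exact_mod_cast this
  have e1 := abs_lt.1 (hN₁ N (by omega))
  have e2 := abs_lt.1 (hN₂ N (by omega))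
  have e3 := abs_lt.1 (hM m hmM)
  have upper : ∑ k ∈ Finset.range N, (popFlow 0 (k + 1) (k + 1) w : ℝ)
      ≤ ∑ k ∈ Finset.range N, (popFlow 0 m (k + 1) w : ℝ) + ε / 4 * N := by
    have : ∑ k ∈ Finset.range N, (popFlow 0 (k + 1) (k + 1) w : ℝ)
        ≤ ∑ k ∈ Finset.range N, (statFlow (k + 1) w : ℝ) :=
      Finset.sum_le_sum fun k _ => Nat.cast_le.2 (popFlow_le_statFlow (hbd _) _)
    nlinarith [hm N]
  have lower : ∑ k ∈ Finset.range N, (popFlow 0 m (k + 1) w : ℝ)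
      ≤ ∑ k ∈ Finset.range N, (popFlow 0 (k + 1) (k + 1) w : ℝ) + C := by
    have s1 : ∑ k ∈ Finset.range N, (popFlow 0 m (k + 1) w : ℝ)
        ≤ ∑ k ∈ Finset.range N, ((popFlow 0 (k + 1) (k + 1) w : ℝ)
          + if k < m then (popFlow 0 m (k + 1) w : ℝ) else 0) := by
      refine Finset.sum_le_sum fun k _ => ?_
      split_ifs with h
      · linarith [Nat.cast_nonneg (α := ℝ) (popFlow 0 (k + 1) (k + 1) w)]
      · rw [add_zero]
        exact Nat.cast_le.2 (popFlow_zero_mono _ _ (by omega))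
    rw [Finset.sum_add_distrib, ← Finset.sum_filter] at s1
    refine s1.trans (add_le_add le_rfl ?_)
    exact Finset.sum_le_sum_of_subset_of_nonneg (fun k hk => by
      simpa using (Finset.mem_filter.1 hk).2) fun _ _ _ => Nat.cast_nonneg _
  have upper' := div_le_div_of_nonneg_right upper hNpos.le
  have lower' := div_le_div_of_nonneg_right lower hNpos.le
  rw [add_div, mul_div_cancel_right₀ _ hNpos.ne'] at upper'
  rw [add_div] at lower'
  rw [Real.dist_eq, abs_lt]
  constructor <;> linarith

end law

/-! ### Existence and uniqueness of the stationary law -/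

section stationarity

variable (ρ : Measure Noise) [IsProbabilityMeasure ρ]

/-- The law of the stationary population. -/
noncomputable def statLaw : Measure ℕ := (noiseLaw ρ).map (statFlow 0)

instance : IsProbabilityMeasure (statLaw ρ) :=
  Measure.isProbabilityMeasure_map (measurable_statFlow' 0).aemeasurable

theorem measurable_popFlow_path :
    Measurable fun (p : ℕ × (ℤ → Noise)) (n : ℕ) => popFlow p.1 n n p.2 :=
  measurable_pi_lambda _ fun n => measurable_from_prod_countable_right fun x =>
    measurable_popFlow' x n n

/-- The noise at positive times. -/
def futureNoise (w : ℤ → Noise) : ℤ → Noise := fun i => if 0 < i then w i else (fun _ => 0, 0)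

theorem measurable_futureNoise : Measurable[noiseSigma (Set.Ioi 0)] futureNoise := by
  refine @measurable_pi_lambda _ _ _ (noiseSigma (Set.Ioi 0)) _ _ fun i => ?_
  unfold futureNoise
  by_cases h : 0 < i
  · simp only [h, if_true]
    exact measurable_noiseSigma_eval h
  · simp only [h, if_false]
    exact measurable_const

theorem popFlow_futureNoise (x : ℕ) {m : ℕ} {n : ℤ} (h : (m : ℤ) ≤ n) (w : ℤ → Noise) :
    popFlow x m n (futureNoise w) = popFlow x m n w := by
  induction m generalizing n with
  | zero => rfl
  | succ m ih =>
    have hn : 0 < n := by omega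
    simp only [popFlow]
    rw [ih (by omega)]
    simp [futureNoise, hn]

/-- `statFlow 0` uses noise up to time `0` and the path afterwards only positive times. Replacing
the noise by `futureNoise` makes the two independent, so the product measure can be realised on a
single noise sequence, where the path is `statFlow` itself. -/
theorem map_path_statLaw_prod {a z : ENNReal} (hb : ∀ k, ∫⁻ e, (e.1 k : ENNReal) ∂ρ = a)
    (hz : ∫⁻ e, (e.2 : ENNReal) ∂ρ = z) (ha : a < 1) (hzt : z ≠ ⊤) :
    ((statLaw ρ).prod (noiseLaw ρ)).map (fun p (n : ℕ) => popFlow p.1 n n p.2)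
      = (noiseLaw ρ).map fun w (n : ℕ) => statFlow n w := by
  have hfm : Measurable futureNoise := measurable_futureNoise.mono (noiseSigma_le _) le_rfl
  have hind : IndepFun (statFlow 0) futureNoise (noiseLaw ρ) :=
    indepFun_of_noiseSigma ρ (S := Set.Iic 0) (T := Set.Ioi 0)
      (Set.Iic_disjoint_Ioi le_rfl) (measurable_statFlow 0) measurable_futureNoise
  have hprod := (indepFun_iff_map_prod_eq_prod_map_map (measurable_statFlow' 0).aemeasurable
    hfm.aemeasurable).1 hind
  have hid : (fun (p : ℕ × (ℤ → Noise)) (n : ℕ) => popFlow p.1 n n p.2)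
      = (fun (p : ℕ × (ℤ → Noise)) (n : ℕ) => popFlow p.1 n n p.2) ∘ Prod.map id futureNoise := by
    funext p n
    simp only [Function.comp_apply, Prod.map_fst, Prod.map_snd, id]
    rw [popFlow_futureNoise _ le_rfl]
  conv_lhs => rw [hid]
  rw [← Measure.map_map measurable_popFlow_path (measurable_id.prodMap hfm),
    ← Measure.map_prod_map _ _ measurable_id hfm, Measure.map_id, statLaw, ← hprod,
    Measure.map_map measurable_popFlow_path ((measurable_statFlow' 0).prodMk hfm)]
  refine Measure.map_congr ?_
  filter_upwards [ae_bddAbove_popFlow hb hz ha hzt] with w hw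
  funext n
  simp only [Function.comp_apply]
  rw [popFlow_futureNoise _ le_rfl]
  induction n with
  | zero => rfl
  | succ n ih =>
    have h1 : ((n + 1 : ℕ) : ℤ) - 1 = n := by push_cast; ring
    simp only [popFlow]
    rw [h1, ih]
    have := statFlow_succ_eq (n := n) hw
    push_cast
    exact this.symm

/-- On the `statFlow` side, advancing the path by one step is the noise shift, which preserves the
law. -/
theorem map_succ_path_statLaw_prod {a z : ENNReal} (hb : ∀ k, ∫⁻ e, (e.1 k : ENNReal) ∂ρ = a)
    (hz : ∫⁻ e, (e.2 : ENNReal) ∂ρ = z) (ha : a < 1) (hzt : z ≠ ⊤) :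
    ((statLaw ρ).prod (noiseLaw ρ)).map (fun p (n : ℕ) => popFlow p.1 (n + 1) (n + 1) p.2)
      = ((statLaw ρ).prod (noiseLaw ρ)).map (fun p (n : ℕ) => popFlow p.1 n n p.2) := by
  have hS : Measurable fun (w : ℤ → Noise) (n : ℕ) => statFlow n w :=
    measurable_pi_lambda _ fun n => measurable_statFlow' n
  have hs : Measurable fun (y : ℕ → ℕ) (n : ℕ) => y (n + 1) := by fun_prop
  have h := congrArg (Measure.map fun (y : ℕ → ℕ) (n : ℕ) => y (n + 1))
    (map_path_statLaw_prod ρ hb hz ha hzt)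
  rw [Measure.map_map hs measurable_popFlow_path, Measure.map_map hs hS] at h
  rw [map_path_statLaw_prod ρ hb hz ha hzt]
  have e1 : ((fun (y : ℕ → ℕ) (n : ℕ) => y (n + 1)) ∘
      fun (p : ℕ × (ℤ → Noise)) (n : ℕ) => popFlow p.1 n n p.2)
      = fun p (n : ℕ) => popFlow p.1 (n + 1) (n + 1) p.2 := by
    funext p n
    simp
  have e2 : ((fun (y : ℕ → ℕ) (n : ℕ) => y (n + 1)) ∘
      fun (w : ℤ → Noise) (n : ℕ) => statFlow n w)
      = (fun (w : ℤ → Noise) (n : ℕ) => statFlow n w) ∘ noiseShift 1 := by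
    funext w n
    simp [← statFlow_add]
  rw [e1, e2, ← Measure.map_map hS (measurable_noiseShift 1),
    (measurePreserving_noiseShift ρ 1).map_eq] at h
  exact h

/-- Shift the time window `(0, n]` back to `(-n, 0]`: each fixed starting state then coalesces with
`statFlow 0`, and dominated convergence integrates this over `π`. -/
theorem eq_statLaw_of_forall_map_eq {a z : ENNReal} (hb : ∀ k, ∫⁻ e, (e.1 k : ENNReal) ∂ρ = a)
    (hz : ∫⁻ e, (e.2 : ENNReal) ∂ρ = z) (ha : a < 1) (hzt : z ≠ ⊤)
    {π : Measure ℕ} [IsProbabilityMeasure π]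
    (h : ∀ n : ℕ, (π.prod (noiseLaw ρ)).map (fun p => popFlow p.1 n n p.2) = π) :
    π = statLaw ρ := by
  refine Measure.ext_of_singleton fun i => ?_
  have hi : MeasurableSet ({i} : Set ℕ) := measurableSet_singleton i
  have h1 : ∀ n : ℕ, π {i} = ∫⁻ x, noiseLaw ρ (popFlow x n 0 ⁻¹' {i}) ∂π := by
    intro n
    have hm : Measurable fun p : ℕ × (ℤ → Noise) => popFlow p.1 n n p.2 :=
      (measurable_pi_apply n).comp measurable_popFlow_path
    conv_lhs => rw [← h n]
    rw [Measure.map_apply hm hi, Measure.prod_apply (hm hi)]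
    refine lintegral_congr fun x => ?_
    rw [← (measurePreserving_noiseShift ρ n).measure_preimage
      (measurable_popFlow' x n 0 hi).nullMeasurableSet]
    congr 1
    ext w
    simp only [Set.mem_preimage, Set.mem_singleton_iff, ← popFlow_add, zero_add]
  have h2 : Tendsto (fun n : ℕ => ∫⁻ x, noiseLaw ρ (popFlow x n 0 ⁻¹' {i}) ∂π) atTop
      (𝓝 (∫⁻ _, noiseLaw ρ (statFlow 0 ⁻¹' {i}) ∂π)) := by
    refine tendsto_lintegral_of_dominated_convergence (fun _ => 1)
      (fun n => measurable_of_countable _) (fun n => Eventually.of_forall fun x => prob_le_one)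
      (by simp) (Eventually.of_forall fun x => ?_)
    refine tendsto_measure_of_ae_tendsto_indicator_of_isFiniteMeasure atTop
      (measurable_statFlow' 0 hi) (fun n => measurable_popFlow' x n 0 hi) ?_
    filter_upwards [ae_eventually_popFlow_eq_statFlow hb hz ha hzt x 0] with w hw
    filter_upwards [hw] with n hn
    simp [hn]
  simp only [← h1, lintegral_const, measure_univ, mul_one] at h2
  rw [statLaw, Measure.map_apply (measurable_statFlow' 0) hi]
  exact tendsto_nhds_unique tendsto_const_nhds h2

end stationarity

/-! ### The coefficients give i.i.d. noise -/

/-- The set of noises agreeing with `e` in the survival indicators indexed by `K` and in the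
number of immigrants. -/
def noiseCylinder (K : Finset ℕ) (e : Noise) : Set Noise :=
  {e' | (∀ k ∈ K, e'.1 k = e.1 k) ∧ e'.2 = e.2}

/-- Any common point can serve as the base point of both cylinders, so they meet in a cylinder over
the union of the index sets. -/
theorem isPiSystem_noiseCylinder :
    IsPiSystem (Set.range fun p : Finset ℕ × Noise => noiseCylinder p.1 p.2) := by
  rintro _ ⟨⟨K, e⟩, rfl⟩ _ ⟨⟨K', e'⟩, rfl⟩ ⟨f, hf, hf'⟩
  refine ⟨(K ∪ K', f), ?_⟩
  ext g
  simp only [noiseCylinder, Set.mem_ofPred_eq, Set.mem_inter_iff] at hf hf' ⊢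
  constructor
  · rintro ⟨h1, h2⟩
    exact ⟨⟨fun k hk => (h1 k (Finset.mem_union_left _ hk)).trans (hf.1 k hk), h2.trans hf.2⟩,
      fun k hk => (h1 k (Finset.mem_union_right _ hk)).trans (hf'.1 k hk), h2.trans hf'.2⟩
  · rintro ⟨⟨h1, h2⟩, h3, -⟩
    refine ⟨fun k hk => ?_, h2.trans hf.2.symm⟩
    rcases Finset.mem_union.1 hk with hk | hk
    · exact (h1 k hk).trans (hf.1 k hk).symm
    · exact (h3 k hk).trans (hf'.1 k hk).symm

theorem measurableSet_noiseCylinder (K : Finset ℕ) (e : Noise) :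
    MeasurableSet (noiseCylinder K e) := by
  have h : noiseCylinder K e
      = (⋂ k ∈ K, (fun e' : Noise => e'.1 k) ⁻¹' {e.1 k}) ∩ Prod.snd ⁻¹' {e.2} := by
    ext; simp [noiseCylinder]
  rw [h]
  exact (Finset.measurableSet_biInter _ fun k _ =>
    (show Measurable fun e' : Noise => e'.1 k by fun_prop) (measurableSet_singleton _)).inter
    (measurable_snd (measurableSet_singleton _))

theorem generateFrom_noiseCylinder :
    (inferInstance : MeasurableSpace Noise) = MeasurableSpace.generateFrom
      (Set.range fun p : Finset ℕ × Noise => noiseCylinder p.1 p.2) := by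
  refine le_antisymm ?_ (MeasurableSpace.generateFrom_le ?_)
  · set m := MeasurableSpace.generateFrom
      (Set.range fun p : Finset ℕ × Noise => noiseCylinder p.1 p.2) with hm
    have hcyl : ∀ K e, MeasurableSet[m] (noiseCylinder K e) := fun K e =>
      MeasurableSpace.measurableSet_generateFrom ⟨(K, e), rfl⟩
    refine sup_le ?_ ?_
    · refine measurable_iff_comap_le.1 (@measurable_pi_lambda _ _ _ m _ _ fun k => ?_)
      refine @measurable_to_countable' _ _ _ _ m _ fun j => ?_
      have h : (fun e : Noise => e.1 k) ⁻¹' {j} = ⋃ z, noiseCylinder {k} (fun _ => j, z) := by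
        ext; simp [noiseCylinder]
      rw [h]
      exact @MeasurableSet.iUnion _ _ m _ _ fun z => hcyl _ _
    · refine measurable_iff_comap_le.1 (@measurable_to_countable' _ _ _ _ m _ fun j => ?_)
      have h : (Prod.snd : Noise → ℕ) ⁻¹' {j} = noiseCylinder ∅ (fun _ => 0, j) := by
        ext; simp [noiseCylinder]
      rw [h]
      exact hcyl _ _
  · rintro _ ⟨⟨K, e⟩, rfl⟩
    exact measurableSet_noiseCylinder K e

/-- The mass function at `b` of the Bernoulli law with parameter `x`. -/
noncomputable def bernoulliMass (b : ℕ) (x : ℝ) : ℝ :=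
  if b = 1 then x else if b = 0 then 1 - x else 0

theorem measurable_bernoulliMass (b : ℕ) : Measurable (bernoulliMass b) := by
  unfold bernoulliMass
  split_ifs <;> fun_prop

/-- The noise driving the process. -/
def coeffNoise {Ω : Type*} (Z : ℤ → Ω → ℕ) (B : ℤ → ℕ → Ω → ℕ) (n : ℤ) (ω : Ω) : Noise :=
  (fun k => B n k ω, Z n ω)

theorem rcinar_eq_popFlow {Ω : Type*} (Z : ℤ → Ω → ℕ) (B : ℤ → ℕ → Ω → ℕ) (X₀ : Ω → ℕ)
    (n : ℕ) (ω : Ω) :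
    rcinar B Z X₀ n ω = popFlow (X₀ ω) n n (fun i => coeffNoise Z B i ω) := by
  induction n with
  | zero => rfl
  | succ n ih =>
    simp only [rcinar, popFlow, popStep, coeffNoise] at ih ⊢
    rw [ih, show ((n + 1 : ℕ) : ℤ) - 1 = n by push_cast; ring, Nat.cast_succ]

namespace IsRCINARCoeff

variable {Ω : Type*} [MeasurableSpace Ω] {μ : Measure Ω}
  {Φ : ℤ → Ω → ℝ} {Z : ℤ → Ω → ℕ} {B : ℤ → ℕ → Ω → ℕ} (h : IsRCINARCoeff μ Φ Z B)

include h

theorem envSigma_le : envSigma Φ ≤ (inferInstance : MeasurableSpace Ω) :=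
  (measurable_pi_lambda _ h.measurable_env).comap_le

theorem measurableSet_thin (n : ℤ) (k b : ℕ) : MeasurableSet (B n k ⁻¹' {b}) :=
  h.measurable_thin n k (measurableSet_singleton b)

theorem measurable_coeffNoise (n : ℤ) : Measurable (coeffNoise Z B n) :=
  (measurable_pi_lambda _ fun k => h.measurable_thin n k).prodMk (h.measurable_imm n)

theorem lintegral_imm :
    ∫⁻ e, (e.2 : ENNReal) ∂μ.map (coeffNoise Z B 0) = ∫⁻ ω, (Z 0 ω : ENNReal) ∂μ := by
  have hm : Measurable fun e : Noise => (e.2 : ENNReal) :=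
    (measurable_of_countable (fun n : ℕ => (n : ENNReal))).comp measurable_snd
  rw [lintegral_map hm (h.measurable_coeffNoise 0)]
  rfl

variable [IsProbabilityMeasure μ]

theorem integrable_env (n : ℤ) : Integrable (Φ n) μ :=
  Integrable.of_bound (h.measurable_env n).aestronglyMeasurable 1
    (Eventually.of_forall fun ω => by
      rw [Real.norm_eq_abs, abs_le]
      constructor <;> linarith [(h.env_mem n ω).1, (h.env_mem n ω).2])

theorem measureReal_eq_integral_of_condExp {A : Set Ω} (hA : MeasurableSet A) {f : Ω → ℝ}
    (hf : μ⟦A | envSigma Φ⟧ =ᵐ[μ] f) : μ.real A = ∫ ω, f ω ∂μ := by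
  rw [← integral_congr_ae hf, integral_condExp h.envSigma_le, integral_indicator_const _ hA]
  simp

theorem measureReal_thin_one (n : ℤ) (k : ℕ) : μ.real (B n k ⁻¹' {1}) = ∫ ω, Φ n ω ∂μ :=
  h.measureReal_eq_integral_of_condExp (h.measurableSet_thin n k 1) (h.thin_one n k)

/-- The masses at `0` and `1` average to `1 - E[φ_0]` and `E[φ_0]`, leaving nothing for other
values. -/
theorem ae_thin (n : ℤ) (k : ℕ) : ∀ᵐ ω ∂μ, B n k ω = 0 ∨ B n k ω = 1 := by
  have h0 := h.measureReal_eq_integral_of_condExp (h.measurableSet_thin n k 0) (h.thin_zero n k)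
  rw [integral_sub (integrable_const _) (h.integrable_env n), ← h.measureReal_thin_one n k] at h0
  have hd : Disjoint (B n k ⁻¹' {0}) (B n k ⁻¹' {1}) := by
    rw [Set.disjoint_left]
    intro ω h1 h2
    simp only [Set.mem_preimage, Set.mem_singleton_iff] at h1 h2
    omega
  have hu := measureReal_union (μ := μ) hd (h.measurableSet_thin n k 1)
  have h1 : μ.real (B n k ⁻¹' {0} ∪ B n k ⁻¹' {1}) = 1 := by
    rw [hu, h0]; simp
  have hm := (h.measurableSet_thin n k 0).union (h.measurableSet_thin n k 1)
  have h2 : μ (B n k ⁻¹' {0} ∪ B n k ⁻¹' {1}) = 1 := by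
    rw [measureReal_def] at h1
    exact (ENNReal.toReal_eq_one_iff _).1 h1
  exact (mem_ae_iff_prob_eq_one hm).2 h2

theorem condExp_thin (n : ℤ) (k b : ℕ) :
    μ⟦B n k ⁻¹' {b} | envSigma Φ⟧ =ᵐ[μ] fun ω => bernoulliMass b (Φ n ω) := by
  by_cases h1 : b = 1
  · subst h1
    simpa [bernoulliMass] using h.thin_one n k
  by_cases h0 : b = 0
  · subst h0
    simpa [bernoulliMass] using h.thin_zero n k
  have hz : (B n k ⁻¹' {b}).indicator (fun _ => (1 : ℝ)) =ᵐ[μ] 0 := by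
    filter_upwards [h.ae_thin n k] with ω hω
    rw [Set.indicator_of_notMem, Pi.zero_apply]
    simp only [Set.mem_preimage, Set.mem_singleton_iff]
    omega
  refine (condExp_congr_ae hz).trans ?_
  rw [condExp_zero]
  simp only [bernoulliMass, h1, h0, if_false]
  rfl

/-- Conditioning on `Φ` yields a product of Bernoulli masses. Grouped by generation, it is a product
of functions of the independent `Φ n`; indicators sharing a generation must stay under one integral.
-/
theorem measureReal_biInter_thin (S : Finset ℤ) (K : ℤ → Finset ℕ) (b : ℤ → ℕ → ℕ) :
    μ.real {ω | ∀ n ∈ S, ∀ k ∈ K n, B n k ω = b n k}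
      = ∏ n ∈ S, ∫ ω, ∏ k ∈ K n, bernoulliMass (b n k) (Φ 0 ω) ∂μ := by
  classical
  set T : Finset (ℤ × ℕ) := S.biUnion fun n => (K n).image fun k => (n, k) with hT
  have hmem : ∀ p : ℤ × ℕ, p ∈ T ↔ p.1 ∈ S ∧ p.2 ∈ K p.1 := by
    rintro ⟨n, k⟩
    simp [hT]
  have hset : {ω | ∀ n ∈ S, ∀ k ∈ K n, B n k ω = b n k}
      = ⋂ p ∈ T, B p.1 p.2 ⁻¹' {b p.1 p.2} := by
    ext ω
    simp only [Set.mem_ofPred_eq, Set.mem_iInter, hmem, Set.mem_preimage, Set.mem_singleton_iff,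
      Prod.forall, and_imp]
    exact ⟨fun H n k hn hk => H n hn k hk, fun H n hn k hk => H n k hn hk⟩
  have hcond : μ⟦⋂ p ∈ T, B p.1 p.2 ⁻¹' {b p.1 p.2} | envSigma Φ⟧ =ᵐ[μ]
      fun ω => ∏ n ∈ S, ∏ k ∈ K n, bernoulliMass (b n k) (Φ n ω) := by
    refine (h.thin_condIndep T fun p => b p.1 p.2).trans ?_
    have hall : ∀ᵐ ω ∂μ, ∀ p : ℤ × ℕ, (μ⟦B p.1 p.2 ⁻¹' {b p.1 p.2} | envSigma Φ⟧) ω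
        = bernoulliMass (b p.1 p.2) (Φ p.1 ω) :=
      ae_all_iff.2 fun p => h.condExp_thin p.1 p.2 _
    filter_upwards [hall] with ω hω
    rw [Finset.prod_congr rfl fun p _ => hω p, Finset.prod_finset_product T S K hmem]
  rw [hset, h.measureReal_eq_integral_of_condExp
    (Finset.measurableSet_biInter _ fun p _ => h.measurableSet_thin _ _ _) hcond]
  have hq : ∀ n, Measurable fun x : ℝ => ∏ k ∈ K n, bernoulliMass (b n k) x := fun n =>
    Finset.measurable_prod _ fun k _ => measurable_bernoulliMass _
  have hind := iIndepFun.integral_fun_prod_comp (X := fun n : S => Φ n)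
    (f := fun (n : S) x => ∏ k ∈ K n, bernoulliMass (b n k) x)
    (h.env_indep.precomp (g := ((↑) : S → ℤ)) Subtype.val_injective)
    (fun i => (h.measurable_env i).aemeasurable)
    (fun i => (hq i).aestronglyMeasurable)
  calc ∫ ω, ∏ n ∈ S, ∏ k ∈ K n, bernoulliMass (b n k) (Φ n ω) ∂μ
      = ∫ ω, ∏ n : S, ∏ k ∈ K n, bernoulliMass (b n k) (Φ n ω) ∂μ := by
        refine integral_congr_ae (Eventually.of_forall fun ω => ?_)
        exact (Finset.prod_coe_sort S
          fun n => ∏ k ∈ K n, bernoulliMass (b n k) (Φ n ω)).symm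
    _ = ∏ n : S, ∫ ω, ∏ k ∈ K n, bernoulliMass (b n k) (Φ n ω) ∂μ := hind
    _ = ∏ n ∈ S, ∫ ω, ∏ k ∈ K n, bernoulliMass (b n k) (Φ n ω) ∂μ :=
        Finset.prod_coe_sort S fun n => ∫ ω, ∏ k ∈ K n, bernoulliMass (b n k) (Φ n ω) ∂μ
    _ = _ := Finset.prod_congr rfl fun n _ => ((h.env_ident n).comp (hq n)).integral_eq

theorem measureReal_biInter_coeffNoise (S : Finset ℤ) (K : ℤ → Finset ℕ) (e : ℤ → Noise) :
    μ.real (⋂ n ∈ S, coeffNoise Z B n ⁻¹' noiseCylinder (K n) (e n))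
      = ∏ n ∈ S, ((∫ ω, ∏ k ∈ K n, bernoulliMass ((e n).1 k) (Φ 0 ω) ∂μ)
          * μ.real (Z 0 ⁻¹' {(e n).2})) := by
  have hset : ⋂ n ∈ S, coeffNoise Z B n ⁻¹' noiseCylinder (K n) (e n)
      = (fun ω n k => B n k ω) ⁻¹' {x | ∀ n ∈ S, ∀ k ∈ K n, x n k = (e n).1 k}
        ∩ (fun ω n => Z n ω) ⁻¹' {y | ∀ n ∈ S, y n = (e n).2} := by
    ext ω
    simp only [Set.mem_iInter, Set.mem_preimage, noiseCylinder, coeffNoise, Set.mem_ofPred_eq,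
      Set.mem_inter_iff]
    exact ⟨fun H => ⟨fun n hn => (H n hn).1, fun n hn => (H n hn).2⟩,
      fun H n hn => ⟨H.1 n hn, H.2 n hn⟩⟩
  have hm1 : MeasurableSet {x : ℤ → ℕ → ℕ | ∀ n ∈ S, ∀ k ∈ K n, x n k = (e n).1 k} := by
    have : {x : ℤ → ℕ → ℕ | ∀ n ∈ S, ∀ k ∈ K n, x n k = (e n).1 k}
        = ⋂ n ∈ S, ⋂ k ∈ K n, (fun x : ℤ → ℕ → ℕ => x n k) ⁻¹' {(e n).1 k} := by
      ext; simp
    rw [this]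
    exact Finset.measurableSet_biInter _ fun n _ => Finset.measurableSet_biInter _ fun k _ =>
      (show Measurable fun x : ℤ → ℕ → ℕ => x n k by fun_prop) (measurableSet_singleton _)
  have hm2 : MeasurableSet {y : ℤ → ℕ | ∀ n ∈ S, y n = (e n).2} := by
    have : {y : ℤ → ℕ | ∀ n ∈ S, y n = (e n).2}
        = ⋂ n ∈ S, (fun y : ℤ → ℕ => y n) ⁻¹' {(e n).2} := by
      ext; simp
    rw [this]
    exact Finset.measurableSet_biInter _ fun n _ =>
      measurable_pi_apply n (measurableSet_singleton _)
  have hZ : μ.real ((fun ω n => Z n ω) ⁻¹' {y : ℤ → ℕ | ∀ n ∈ S, y n = (e n).2})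
      = ∏ n ∈ S, μ.real (Z 0 ⁻¹' {(e n).2}) := by
    have h1 : (fun ω n => Z n ω) ⁻¹' {y : ℤ → ℕ | ∀ n ∈ S, y n = (e n).2}
        = ⋂ n ∈ S, Z n ⁻¹' {(e n).2} := by
      ext; simp
    rw [h1, measureReal_def, h.imm_indep.measure_inter_preimage_eq_mul S
      (fun n _ => measurableSet_singleton _), ENNReal.toReal_prod]
    refine Finset.prod_congr rfl fun n _ => ?_
    rw [(h.imm_ident n).measure_mem_eq (measurableSet_singleton _), measureReal_def]
  rw [hset, measureReal_def, h.thin_imm_indep.measure_inter_preimage_eq_mul _ _ hm1 hm2,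
    ENNReal.toReal_mul, ← measureReal_def, ← measureReal_def, hZ, Finset.prod_mul_distrib]
  congr 1
  exact h.measureReal_biInter_thin S K fun n => (e n).1

theorem measureReal_coeffNoise (n : ℤ) (K : Finset ℕ) (e : Noise) :
    μ.real (coeffNoise Z B n ⁻¹' noiseCylinder K e)
      = (∫ ω, ∏ k ∈ K, bernoulliMass (e.1 k) (Φ 0 ω) ∂μ) * μ.real (Z 0 ⁻¹' {e.2}) := by
  simpa using h.measureReal_biInter_coeffNoise {n} (fun _ => K) fun _ => e

/-- Cylinder probabilities factor over generations, and cylinders form a generating π-system. -/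
theorem iIndepFun_coeffNoise : iIndepFun (coeffNoise Z B) μ := by
  refine iIndepSets.iIndep (fun n => (h.measurable_coeffNoise n).comap_le)
    (fun n => {s | ∃ t ∈ Set.range fun p : Finset ℕ × Noise => noiseCylinder p.1 p.2,
      coeffNoise Z B n ⁻¹' t = s}) (fun n => isPiSystem_noiseCylinder.comap _) (fun n => ?_) ?_
  · conv_lhs => rw [show (Prod.instMeasurableSpace : MeasurableSpace Noise) = _
      from generateFrom_noiseCylinder]
    rw [MeasurableSpace.comap_generateFrom]
    rfl
  · rw [iIndepSets_iff]
    intro S f hf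
    have hf' : ∀ n, ∃ p : Finset ℕ × Noise, n ∈ S →
        f n = coeffNoise Z B n ⁻¹' noiseCylinder p.1 p.2 := by
      intro n
      by_cases hn : n ∈ S
      · obtain ⟨_, ⟨p, rfl⟩, hp⟩ := hf n hn
        exact ⟨p, fun _ => hp.symm⟩
      · exact ⟨(∅, fun _ => 0, 0), fun hn' => absurd hn' hn⟩
    choose p hp using hf'
    rw [Set.iInter₂_congr hp, Finset.prod_congr rfl fun n hn => congrArg μ (hp n hn)]
    rw [← ENNReal.toReal_eq_toReal_iff' (measure_ne_top _ _)
      (ENNReal.prod_ne_top fun _ _ => measure_ne_top _ _), ENNReal.toReal_prod]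
    have := h.measureReal_biInter_coeffNoise S (fun n => (p n).1) fun n => (p n).2
    rw [← measureReal_def, this]
    exact Finset.prod_congr rfl fun n _ => (h.measureReal_coeffNoise n _ _).symm

theorem map_coeffNoise_eq (n : ℤ) : μ.map (coeffNoise Z B n) = μ.map (coeffNoise Z B 0) := by
  have h1 := Measure.isProbabilityMeasure_map (μ := μ) (h.measurable_coeffNoise n).aemeasurable
  have h2 := Measure.isProbabilityMeasure_map (μ := μ) (h.measurable_coeffNoise 0).aemeasurable
  refine ext_of_generate_finite _ generateFrom_noiseCylinder isPiSystem_noiseCylinder ?_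
    (by simp)
  rintro _ ⟨⟨K, e⟩, rfl⟩
  rw [Measure.map_apply (h.measurable_coeffNoise n) (measurableSet_noiseCylinder K e),
    Measure.map_apply (h.measurable_coeffNoise 0) (measurableSet_noiseCylinder K e),
    ← ENNReal.toReal_eq_toReal_iff' (measure_ne_top _ _) (measure_ne_top _ _)]
  exact (h.measureReal_coeffNoise n K e).trans (h.measureReal_coeffNoise 0 K e).symm

theorem map_coeffNoise_path :
    μ.map (fun ω n => coeffNoise Z B n ω)
      = Measure.infinitePi fun _ : ℤ => μ.map (coeffNoise Z B 0) := by
  rw [h.iIndepFun_coeffNoise.map_fun_eq_infinitePi_map h.measurable_coeffNoise]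
  simp only [h.map_coeffNoise_eq]

theorem lintegral_thin (k : ℕ) :
    ∫⁻ e, (e.1 k : ENNReal) ∂μ.map (coeffNoise Z B 0) = ENNReal.ofReal (∫ ω, Φ 0 ω ∂μ) := by
  have hm : Measurable fun e : Noise => (e.1 k : ENNReal) :=
    (measurable_of_countable (fun n : ℕ => (n : ENNReal))).comp (by fun_prop)
  rw [lintegral_map hm (h.measurable_coeffNoise 0), ← h.measureReal_thin_one 0 k,
    ofReal_measureReal, ← lintegral_indicator_one (h.measurableSet_thin 0 k 1)]
  refine lintegral_congr_ae ?_
  filter_upwards [h.ae_thin 0 k] with ω hω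
  rcases hω with hω | hω <;> simp [coeffNoise, Set.indicator, hω]

theorem integral_env_lt_one (h1 : μ {ω | Φ 0 ω = 1} < 1) : ∫ ω, Φ 0 ω ∂μ < 1 := by
  by_contra hc
  have hi : Integrable (fun ω => 1 - Φ 0 ω) μ := (integrable_const _).sub (h.integrable_env 0)
  have h0 : 0 ≤ fun ω => 1 - Φ 0 ω := fun ω => by
    have := (h.env_mem 0 ω).2
    simp only [Pi.zero_apply]; linarith
  have hz : ∫ ω, (1 - Φ 0 ω) ∂μ = 0 := by
    refine le_antisymm ?_ (integral_nonneg h0)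
    rw [integral_sub (integrable_const _) (h.integrable_env 0)]
    simp only [integral_const, probReal_univ, smul_eq_mul, mul_one]
    linarith
  have hae := (integral_eq_zero_iff_of_nonneg h0 hi).1 hz
  refine h1.ne ((mem_ae_iff_prob_eq_one
    (h.measurable_env 0 (measurableSet_singleton 1))).1 ?_)
  filter_upwards [hae] with ω hω
  simp only [Pi.zero_apply] at hω
  simp only [Set.mem_preimage, Set.mem_singleton_iff]
  linarith

end IsRCINARCoeff

/-! ### Transfer to the original process -/

theorem partialSum_rcinar_eq {Ω : Type*} (Z : ℤ → Ω → ℕ) (B : ℤ → ℕ → Ω → ℕ) (n : ℕ) (ω : Ω) :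
    (partialSum (rcinar B Z fun _ => 0) n ω : ℝ) = ∑ k ∈ Finset.range n,
      (popFlow 0 (k + 1) (k + 1) (fun i => coeffNoise Z B i ω) : ℝ) := by
  induction n with
  | zero => simp [partialSum]
  | succ n ih =>
    rw [Finset.sum_range_succ, ← ih, partialSum, Finset.sum_Icc_succ_top (by omega), Nat.cast_add,
      rcinar_eq_popFlow]
    simp [partialSum]

theorem proposition5 {Ω : Type*} [MeasurableSpace Ω] (μ : Measure Ω) [IsProbabilityMeasure μ]
    (Φ : ℤ → Ω → ℝ) (Z : ℤ → Ω → ℕ) (B : ℤ → ℕ → Ω → ℕ)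
    (hcoeff : IsRCINARCoeff μ Φ Z B)
    (hA1 : μ {ω | Φ 0 ω = 1} < 1)
    (hA4 : Integrable (fun ω => (Z 0 ω : ℝ)) μ) :
    ∃ π : Measure ℕ, IsStationaryLaw μ Z B π ∧
      (∀ π' : Measure ℕ, IsStationaryLaw μ Z B π' → π' = π) ∧
      Integrable (fun x : ℕ => (x : ℝ)) π ∧
      (∀ᵐ ω ∂μ, Tendsto
        (fun n : ℕ => (partialSum (rcinar B Z (fun _ => 0)) n ω : ℝ) / (n : ℝ))
        atTop (𝓝 (∫ x : ℕ, (x : ℝ) ∂π))) ∧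
      ∫ x : ℕ, (x : ℝ) ∂π = (∫ ω, (Z 0 ω : ℝ) ∂μ) / (1 - ∫ ω, Φ 0 ω ∂μ) := by
  have hρ := Measure.isProbabilityMeasure_map (μ := μ) (hcoeff.measurable_coeffNoise 0).aemeasurable
  have hlaw := hcoeff.map_coeffNoise_path
  have hb := hcoeff.lintegral_thin
  have hz := hcoeff.lintegral_imm
  have hmean := hcoeff.integral_env_lt_one hA1
  have hΦ0 : 0 ≤ ∫ ω, Φ 0 ω ∂μ := integral_nonneg fun ω => (hcoeff.env_mem 0 ω).1
  have ha : ENNReal.ofReal (∫ ω, Φ 0 ω ∂μ) < 1 := by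
    rwa [ENNReal.ofReal_lt_one]
  have hzt : ∫⁻ ω, (Z 0 ω : ENNReal) ∂μ ≠ ⊤ := by
    have := hA4.lintegral_lt_top.ne
    simpa using this
  -- From here on, the noise enters only through its being i.i.d. with law `ρ` and through the means
  -- `hb` and `hz`.
  generalize μ.map (coeffNoise Z B 0) = ρ at *
  have hξ : Measurable fun ω n => coeffNoise Z B n ω :=
    measurable_pi_lambda _ hcoeff.measurable_coeffNoise
  have hpath : ∀ p : ℕ × Ω, ∀ n : ℕ,
      rcinar (fun n k (p : ℕ × Ω) => B n k p.2) (fun n p => Z n p.2) (fun p => p.1) n p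
        = popFlow p.1 n n (fun i => coeffNoise Z B i p.2) := fun p n =>
    rcinar_eq_popFlow _ _ _ n p
  have hprod : ∀ π : Measure ℕ, IsProbabilityMeasure π →
      (π.prod μ).map (Prod.map id fun ω n => coeffNoise Z B n ω) = π.prod (noiseLaw ρ) := by
    intro π hπ
    rw [← Measure.map_prod_map _ _ measurable_id hξ, Measure.map_id, hlaw]
  have hmapped : ∀ π : Measure ℕ, IsProbabilityMeasure π → ∀ {α : Type} [MeasurableSpace α]
      {F : ℕ × (ℤ → Noise) → α}, Measurable F →
      (π.prod μ).map (fun p => F (p.1, fun i => coeffNoise Z B i p.2))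
        = (π.prod (noiseLaw ρ)).map F := by
    intro π hπ α _ F hF
    rw [← hprod π hπ, Measure.map_map hF (measurable_id.prodMap hξ)]
    rfl
  have hmean0 : ∫⁻ x, (x : ENNReal) ∂statLaw ρ
      = (∫⁻ ω, (Z 0 ω : ENNReal) ∂μ) * (1 - ENNReal.ofReal (∫ ω, Φ 0 ω ∂μ))⁻¹ := by
    rw [statLaw, lintegral_map (measurable_of_countable _) (measurable_statFlow' 0),
      lintegral_statFlow hb hz ha hzt]
  have hval : ∫ x : ℕ, (x : ℝ) ∂statLaw ρ
      = (∫ ω, (Z 0 ω : ℝ) ∂μ) / (1 - ∫ ω, Φ 0 ω ∂μ) := by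
    rw [integral_natCast_eq_toReal_lintegral (f := fun x : ℕ => x) measurable_id,
      integral_natCast_eq_toReal_lintegral (hcoeff.measurable_imm 0)]
    rw [hmean0, ENNReal.toReal_mul, ENNReal.toReal_inv, ENNReal.toReal_sub_of_le ha.le (by simp),
      ENNReal.toReal_ofReal hΦ0, ENNReal.toReal_one, div_eq_mul_inv]
  refine ⟨statLaw ρ, ⟨inferInstance, ?_⟩, ?_, ?_, ?_, hval⟩
  · simp only [hpath]
    have hs : Measurable fun (y : ℕ → ℕ) (n : ℕ) => y (n + 1) := by fun_prop
    have h1 := hmapped (statLaw ρ) inferInstance measurable_popFlow_path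
    have h2 := hmapped (statLaw ρ) inferInstance (hs.comp measurable_popFlow_path)
    simp only [Function.comp_def] at h2
    rw [h1, h2, ← map_succ_path_statLaw_prod ρ hb hz ha hzt]
    simp
  · rintro π ⟨hπ, hst⟩
    simp only [hpath] at hst
    refine eq_statLaw_of_forall_map_eq ρ hb hz ha hzt fun n => ?_
    have hm : ∀ n : ℕ, Measurable fun p : ℕ × (ℤ → Noise) => popFlow p.1 n n p.2 := fun n =>
      (measurable_pi_apply n).comp measurable_popFlow_path
    have hm' : ∀ n : ℕ, Measurable fun p : ℕ × Ω =>
        popFlow p.1 n n (fun i => coeffNoise Z B i p.2) := fun n =>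
      (hm n).comp (measurable_id.prodMap hξ)
    rw [← hmapped π hπ (hm n)]
    induction n with
    | zero => simp [popFlow, Measure.map_fst_prod]
    | succ n ih =>
      -- The `n`-th marginal of the path identity says that the states at times `n + 1` and `n` have
      -- the same law.
      have := congrArg (Measure.map fun y : ℕ → ℕ => y n) hst
      rw [Measure.map_map (measurable_pi_apply n) (measurable_pi_lambda _ fun n => hm' (n + 1)),
        Measure.map_map (measurable_pi_apply n) (measurable_pi_lambda _ hm')] at this
      exact this.trans ih
  · refine integrable_natCast_of_lintegral_ne_top (f := fun x : ℕ => x) measurable_id ?_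
    rw [hmean0]
    exact mul_inv_one_sub_ne_top ha hzt
  · have hlim := ae_tendsto_average_popFlow_diag hb hz ha hzt
    rw [noiseLaw, ← hlaw] at hlim
    have heq : ∫ w, (statFlow 1 w : ℝ) ∂noiseLaw ρ = ∫ x : ℕ, (x : ℝ) ∂statLaw ρ := by
      rw [integral_natCast_eq_toReal_lintegral (measurable_statFlow' 1),
        integral_natCast_eq_toReal_lintegral (f := fun x : ℕ => x) measurable_id, lintegral_statFlow hb hz ha hzt,
        ← hmean0]
    filter_upwards [ae_of_ae_map hξ.aemeasurable hlim] with ω hω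
    simp only [partialSum_rcinar_eq]
    rw [← heq, noiseLaw, ← hlaw]
    exact hω
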